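/- For an integer-valued random variable $X$ on a probability space $(\Omega,\mathcal F,\mathbb P)$ put $$\Delta_\infty(X) := \Big(\sup_{k\in\mathbb Z}\mathbb P(X=k)\Big)^{-2}-1 .$$ Let $n$ be a natural number and let $X_1,\dots,X_n$ be independent integer-valued random variables defined on a common probability space. Then $$\Delta_\infty(X_1+\cdots+X_n)\ \ge\ \frac1{22}\sum_{i=1}^n\Delta_\infty(X_i).$$ -/

import Mathlib

open MeasureTheory ProbabilityTheory

/-- The supremum norm `‖f_X‖_∞ = sup_k P(X = k)` of the probability mass function
`k ↦ P(X = k)` of an integer-valued random variable `X`. -/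
noncomputable def maxProb {Ω : Type*} [MeasurableSpace Ω] (P : Measure Ω) (X : Ω → ℤ) : ℝ :=
  ⨆ k : ℤ, P.real {ω | X ω = k}

/-- The functional `Δ_∞(X) = ‖f_X‖_∞ ^ (-2) - 1`. For a probability measure and a measurable `X`
the number `‖f_X‖_∞` lies in `(0, 1]`, so that no degenerate value of the inverse occurs. -/
noncomputable def deltaInfty {Ω : Type*} [MeasurableSpace Ω] (P : Measure Ω) (X : Ω → ℤ) : ℝ :=
  maxProb P X ^ (-2 : ℤ) - 1

/-! Let D be the sum of the Δ_∞(X_i). A sum of independent variables is no more concentrated than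
any summand (`maxProb_sum_le`), so only the case Δ_∞(X_i) ≤ D/22 for all i remains. There, Fourier
inversion modulo a large prime p bounds P(S = k) by the average over frequencies of ∏ |f_i|, with
f_i the characteristic functions mod p (`prob_sum_le`). Weighted AM-GM with θ_i = Δ_∞(X_i)/D reduces
this to averages of |f_i|^(2q) with q = 1/(2θ_i) ≥ 11. By `sum_norm_integral_rpow_le` each is at
most 1/p + (1 + qΔ_∞(X_i)/11)^(-1/2), up to a tail error in Δ_∞ that vanishes as p → ∞. Since
qΔ_∞(X_i)/11 = D/22 for every i, the limit is (1 + D/22)^(-1/2).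

The moment bound rests on N = 1 - |f|². Its square root behaves like a subadditive function, so the
k-fold sumset of {N ≤ s} lies in {N ≤ k²s}, and Cauchy–Davenport makes the latter about k times as
large. But N has mean 1 - Σ w_r² ≥ 1 - M, so its level sets at moderate heights cannot be large.
Hence {N ≤ s} has, apart from one point, density O(√s), which the layer cake formula turns into a
bound on moments. -/

open scoped Pointwise

/-- Iterated Cauchy–Davenport: `k`-fold sumsets in `ZMod p`. -/
theorem ZMod.card_nsmul_ge {p : ℕ} (hp : p.Prime) {A : Finset (ZMod p)} (hA : A.Nonempty)
    {k : ℕ} (hk : 1 ≤ k) : min p (k * (A.card - 1) + 1) ≤ (k • A).card := by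
  induction k, hk using Nat.le_induction with
  | base =>
    have := hA.card_pos
    simp only [one_nsmul]
    omega
  | succ k hk ih =>
    have hne : (k • A).Nonempty := hA.nsmul
    have h := ZMod.cauchy_davenport hp hne hA
    rw [succ_nsmul]
    have h1 := hA.card_pos
    have h2 : (k + 1) * (A.card - 1) = k * (A.card - 1) + (A.card - 1) := by ring
    omega

/-! ### Growth and size of level sets -/

section LevelSets

variable {p : ℕ} [NeZero p]

/-- The hypothesis is subadditivity of √N, squared and split by (a + b)² ≤ (1 + 1/k)a² + (1 + k)b².
Weight k is sharp when a = kb, so the induction loses nothing: (1 + 1/k)k² + (1 + k) = (k + 1)². -/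
theorem nsmul_levelSet_le {N : ZMod p → ℝ}
    (hN : ∀ k : ℕ, 1 ≤ k → ∀ x y, N (x + y) ≤ (1 + 1 / (k : ℝ)) * N x + (1 + k) * N y)
    {s : ℝ} {k : ℕ} (hk : 1 ≤ k) :
    ∀ x ∈ k • Finset.univ.filter (fun x => N x ≤ s), N x ≤ (k : ℝ) ^ 2 * s := by
  induction k, hk using Nat.le_induction with
  | base => intro x hx; simpa using hx
  | succ k hk ih =>
    intro z hz
    rw [succ_nsmul, Finset.mem_add] at hz
    obtain ⟨x, hx, y, hy, rfl⟩ := hz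
    have hx' := ih x hx
    have hy' : N y ≤ s := by simpa using hy
    have hk0 : (0 : ℝ) < k := by exact_mod_cast hk
    calc N (x + y) ≤ (1 + 1 / (k : ℝ)) * N x + (1 + k) * N y := hN k hk x y
      _ ≤ (1 + 1 / (k : ℝ)) * ((k : ℝ) ^ 2 * s) + (1 + k) * s := by gcongr
      _ = ((k + 1 : ℕ) : ℝ) ^ 2 * s := by push_cast; field_simp; ring

/-- The number of points at which `N` is at most `s`. -/
noncomputable def levelCard (N : ZMod p → ℝ) (s : ℝ) : ℕ :=
  (Finset.univ.filter (fun x => N x ≤ s)).card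

theorem levelCard_le (N : ZMod p → ℝ) (s : ℝ) : levelCard N s ≤ p := by
  unfold levelCard
  exact (Finset.card_le_univ _).trans (by simp [ZMod.card])

theorem levelCard_growth (hp : p.Prime) {N : ZMod p → ℝ} (h0 : N 0 = 0)
    (hN : ∀ k : ℕ, 1 ≤ k → ∀ x y, N (x + y) ≤ (1 + 1 / (k : ℝ)) * N x + (1 + k) * N y)
    {s : ℝ} (hs : 0 ≤ s) {k : ℕ} (hk : 1 ≤ k) (hlt : levelCard N ((k : ℝ) ^ 2 * s) < p) :
    (k : ℝ) * ((levelCard N s : ℝ) - 1) ≤ levelCard N ((k : ℝ) ^ 2 * s) := by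
  have hne : (Finset.univ.filter (fun x => N x ≤ s)).Nonempty := ⟨0, by simp [h0, hs]⟩
  have h1 := ZMod.card_nsmul_ge hp hne hk
  have h2 : (k • Finset.univ.filter (fun x => N x ≤ s)).card ≤ levelCard N ((k : ℝ) ^ 2 * s) :=
    Finset.card_le_card fun x hx => by simpa using nsmul_levelSet_le hN hk x hx
  have h3 := hne.card_pos
  change min p (k * (levelCard N s - 1) + 1) ≤ _ at h1
  change 0 < levelCard N s at h3
  have h4 : k * (levelCard N s - 1) ≤ levelCard N ((k : ℝ) ^ 2 * s) := by omega
  have h5 : ((k * (levelCard N s - 1) : ℕ) : ℝ) ≤ (levelCard N ((k : ℝ) ^ 2 * s) : ℝ) := by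
    exact_mod_cast h4
  rw [Nat.cast_mul, Nat.cast_sub h3] at h5
  simpa using h5

/-- Markov's inequality for c - N: each point of the level set falls short of c by at least c - t,
and the total shortfall is at most p(c - a). -/
theorem levelCard_mul_sub_le {N : ZMod p → ℝ} {a c t : ℝ} (hc : ∀ x, N x ≤ c)
    (hsum : p * a ≤ ∑ x, N x) : levelCard N t * (c - t) ≤ p * (c - a) := by
  have h1 : ∑ x, N x ≤ ∑ x, (c - if N x ≤ t then c - t else 0) := by
    refine Finset.sum_le_sum fun x _ => ?_
    split_ifs with h
    · linarith
    · linarith [hc x]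
  rw [Finset.sum_sub_distrib, ← Finset.sum_filter] at h1
  simp only [Finset.sum_const, Finset.card_univ, ZMod.card, nsmul_eq_mul] at h1
  change _ ≤ _ - (levelCard N t : ℝ) * (c - t) at h1
  linarith

/-- Take k = m - 1 for the least m with m²x ≥ c. As 4x < c, m ≥ 3, so k ≥ 2m/3; this is the source
of 4/9. -/
theorem exists_nat_sq_mul_mem {x c : ℝ} (hx : 0 < x) (hxc : x < c / 4) :
    ∃ k : ℕ, 1 ≤ k ∧ (k : ℝ) ^ 2 * x < c ∧ 4 / 9 * c ≤ (k : ℝ) ^ 2 * x := by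
  have hex : ∃ n : ℕ, c ≤ (n : ℝ) ^ 2 * x := by
    obtain ⟨n, hn⟩ := exists_nat_ge (c / x + 1)
    refine ⟨n, ?_⟩
    have h1 : 1 ≤ c / x + 1 := by
      have : 0 < c / x := by apply div_pos _ hx; linarith
      linarith
    have h2 : c / x ≤ (n : ℝ) ^ 2 := by nlinarith
    rwa [div_le_iff₀ hx] at h2
  classical
  have hm := Nat.find_spec hex
  set m := Nat.find hex with hmdef
  have hm3 : 3 ≤ m := by
    by_contra! h
    have h2 : (m : ℝ) ≤ 2 := by exact_mod_cast (by omega : m ≤ 2)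
    have h3 : (m : ℝ) ^ 2 ≤ 4 := by nlinarith [Nat.cast_nonneg (α := ℝ) m]
    nlinarith
  refine ⟨m - 1, by omega, ?_, ?_⟩
  · have := Nat.find_min hex (m := m - 1) (by omega)
    exact not_le.mp this
  · have h3 : (3 : ℝ) ≤ m := by exact_mod_cast hm3
    have h4 : (2 / 3 * (m : ℝ)) ≤ ((m - 1 : ℕ) : ℝ) := by
      rw [Nat.cast_sub (by omega)]; push_cast; linarith
    have h5 : (2 / 3 * (m : ℝ)) ^ 2 ≤ ((m - 1 : ℕ) : ℝ) ^ 2 := by gcongr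
    nlinarith

/-- Level set bound for small concentration. -/
theorem levelCard_bound_of_le_half (hp : p.Prime) {N : ZMod p → ℝ} (h0 : N 0 = 0)
    (hN : ∀ k : ℕ, 1 ≤ k → ∀ x y, N (x + y) ≤ (1 + 1 / (k : ℝ)) * N x + (1 + k) * N y)
    (hN1 : ∀ x, N x ≤ 1) {M : ℝ} (hM2 : M ≤ 1 / 2)
    (hsum : p * (1 - M) ≤ ∑ x, N x) {s : ℝ} (hs : 0 < s) (hs1 : s < 1) :
    (((levelCard N s : ℝ) - 1) / p) ^ 2 ≤ 8 * M ^ 2 * (s / (1 - s) ^ 2) := by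
  have hp0 : (0 : ℝ) < p := by exact_mod_cast hp.pos
  have hcard : (0 : ℝ) ≤ (levelCard N s : ℝ) - 1 := by
    have : 0 < levelCard N s := Finset.card_pos.mpr ⟨0, by simp [h0, hs.le]⟩
    have : (1 : ℝ) ≤ levelCard N s := by exact_mod_cast this
    linarith
  have hbase : ∀ t, (levelCard N t : ℝ) * (1 - t) ≤ p * M := fun t => by
    have := levelCard_mul_sub_le (t := t) hN1 hsum
    linarith
  set α : ℝ := ((levelCard N s : ℝ) - 1) / p with hα
  have hα0 : 0 ≤ α := div_nonneg hcard hp0.le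
  have hαp : (levelCard N s : ℝ) - 1 = p * α := by rw [hα]; field_simp
  rw [← mul_div_assoc, le_div_iff₀ (by nlinarith)]
  -- If 8s ≥ 1, Markov at level s suffices. Otherwise s is dilated to y = k²s in [2/9, 1/2), and
  -- Markov is applied at y.
  by_cases h8 : 1 / 8 ≤ s
  · have h1 : α * (1 - s) ≤ M := by
      have := hbase s
      have h2 : p * (α * (1 - s)) ≤ p * M := by nlinarith
      exact le_of_mul_le_mul_left h2 hp0
    have h2 : (α * (1 - s)) ^ 2 ≤ M ^ 2 := by
      have : 0 ≤ α * (1 - s) := mul_nonneg hα0 (by linarith)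
      gcongr
    nlinarith [sq_nonneg M]
  · push Not at h8
    obtain ⟨k, hk, hky, hky'⟩ := exists_nat_sq_mul_mem (x := s) (c := 1 / 2) hs (by linarith)
    set y := (k : ℝ) ^ 2 * s with hy
    -- A full level set would give 1 - y ≤ M ≤ 1/2, against y < 1/2, so the cap p in
    -- Cauchy–Davenport is not reached.
    have hlt : levelCard N y < p := by
      have h1 := hbase y
      by_contra! h
      have h2 : (p : ℝ) ≤ levelCard N y := by exact_mod_cast h
      nlinarith
    have h1 := levelCard_growth hp h0 hN hs.le hk hlt
    rw [hαp, ← hy] at h1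
    have hk0 : (0 : ℝ) < k := by exact_mod_cast hk
    have h2 : k * α * (1 - y) ≤ M := by
      have h3 := hbase y
      have h4 : p * (k * α * (1 - y)) ≤ p * M := by nlinarith
      exact le_of_mul_le_mul_left h4 hp0
    have h3 : (k * α * (1 - y)) ^ 2 ≤ M ^ 2 := by
      have : 0 ≤ k * α * (1 - y) := mul_nonneg (by positivity) (by linarith)
      gcongr
    have h4 : 1 ≤ 8 * (y * (1 - y) ^ 2) := by
      nlinarith [mul_nonneg (by linarith : 0 ≤ 1 / 2 - y) (by linarith : 0 ≤ y - 2 / 9),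
        mul_nonneg (mul_nonneg (by linarith : 0 ≤ 1 / 2 - y) (by linarith : 0 ≤ y - 2 / 9))
          (by linarith : 0 ≤ 1 / 2 - y)]
    have h5 : (1 - s) ^ 2 ≤ 1 := by nlinarith
    have h6 : α ^ 2 * 1 ≤ α ^ 2 * (8 * (y * (1 - y) ^ 2)) := by gcongr
    have h7 : α ^ 2 * (8 * (y * (1 - y) ^ 2)) = 8 * s * (k * α * (1 - y)) ^ 2 := by
      rw [hy]; ring
    calc α ^ 2 * (1 - s) ^ 2 ≤ α ^ 2 * 1 := by gcongr
      _ ≤ 8 * s * (k * α * (1 - y)) ^ 2 := by linarith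
      _ ≤ 8 * s * M ^ 2 := by gcongr
      _ = 8 * M ^ 2 * s := by ring

/-- Level set bound relevant for large concentration. -/
theorem levelCard_bound (hp : p.Prime) {N : ZMod p → ℝ} (h0 : N 0 = 0)
    (hN : ∀ k : ℕ, 1 ≤ k → ∀ x y, N (x + y) ≤ (1 + 1 / (k : ℝ)) * N x + (1 + k) * N y)
    {d δ : ℝ} (hδ : 0 < δ) (hd : δ ≤ d) (hN1 : ∀ x, N x ≤ 2 * d)
    (hsum : p * d ≤ ∑ x, N x) {s : ℝ} (hs : 0 < s) :
    (((levelCard N s : ℝ) - 1) / p) ^ 2 ≤ min 1 (4 / (3 * δ) * s) := by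
  have hp0 : (0 : ℝ) < p := by exact_mod_cast hp.pos
  have hcard : (0 : ℝ) ≤ (levelCard N s : ℝ) - 1 := by
    have : 0 < levelCard N s := Finset.card_pos.mpr ⟨0, by simp [h0, hs.le]⟩
    have : (1 : ℝ) ≤ levelCard N s := by exact_mod_cast this
    linarith
  have hbase : ∀ t, 0 ≤ t → (levelCard N t : ℝ) * (2 - t / δ) ≤ p := fun t ht => by
    have h1 := levelCard_mul_sub_le (t := t) hN1 hsum
    have h2 : (levelCard N t : ℝ) * (2 - t / d) ≤ p := by
      have hd0 : 0 < d := by linarith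
      have : (levelCard N t : ℝ) * (2 - t / d) = levelCard N t * (2 * d - t) / d := by
        field_simp
      rw [this, div_le_iff₀ hd0]
      linarith
    have h3 : t / d ≤ t / δ := by gcongr
    have h4 : (0 : ℝ) ≤ levelCard N t := Nat.cast_nonneg _
    nlinarith
  have hcp : (levelCard N s : ℝ) ≤ p := by exact_mod_cast levelCard_le N s
  set α : ℝ := ((levelCard N s : ℝ) - 1) / p with hα
  have hα0 : 0 ≤ α := div_nonneg hcard hp0.le
  have hαp : (levelCard N s : ℝ) - 1 = p * α := by rw [hα]; field_simp
  have hα1 : α ≤ 1 := by rw [hα, div_le_one hp0]; linarith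
  have hsq : α ^ 2 ≤ 1 := by nlinarith
  refine le_min hsq ?_
  set x := s / δ with hx
  have hx0 : 0 < x := by positivity
  have hsx : 4 / (3 * δ) * s = 4 / 3 * x := by rw [hx]; field_simp
  have hsx' : ∀ c : ℝ, c * s / δ = c * x := fun c => by rw [hx]; ring
  rw [hsx]
  -- Three ranges of x = s/δ: the trivial bound α ≤ 1, Markov at level s, and Markov after dilating
  -- x into [4/9, 1).
  by_cases h34 : 3 / 4 ≤ x
  · linarith
  push Not at h34
  by_cases h14 : 1 / 4 ≤ x
  · have h1 : α * (2 - x) ≤ 1 := by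
      have := hbase s hs.le
      have h2 : p * (α * (2 - x)) ≤ p * 1 := by rw [← hx] at this; nlinarith
      exact le_of_mul_le_mul_left h2 hp0
    have h2 : (α * (2 - x)) ^ 2 ≤ 1 := by
      have : 0 ≤ α * (2 - x) := mul_nonneg hα0 (by linarith)
      nlinarith
    have h3 : 1 ≤ 4 / 3 * x * (2 - x) ^ 2 := by
      nlinarith [mul_nonneg (by linarith : 0 ≤ 3 / 4 - x) (by linarith : 0 ≤ x - 1 / 4),
        mul_nonneg (mul_nonneg (by linarith : 0 ≤ 3 / 4 - x) (by linarith : 0 ≤ x - 1 / 4))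
          (by linarith : 0 ≤ 3 / 4 - x)]
    calc α ^ 2 = α ^ 2 * 1 := by ring
      _ ≤ α ^ 2 * (4 / 3 * x * (2 - x) ^ 2) := by gcongr
      _ = 4 / 3 * x * (α * (2 - x)) ^ 2 := by ring
      _ ≤ 4 / 3 * x * 1 := by gcongr
      _ = 4 / 3 * x := by ring
  · push Not at h14
    obtain ⟨k, hk, hky, hky'⟩ := exists_nat_sq_mul_mem (x := x) (c := 1) hx0 (by linarith)
    have hk0 : (0 : ℝ) < k := by exact_mod_cast hk
    have hb := hbase ((k : ℝ) ^ 2 * s) (by positivity)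
    rw [hsx'] at hb
    set y := (k : ℝ) ^ 2 * x with hy
    have hlt : levelCard N ((k : ℝ) ^ 2 * s) < p := by
      by_contra! h
      have h2 : (p : ℝ) ≤ levelCard N ((k : ℝ) ^ 2 * s) := by exact_mod_cast h
      nlinarith
    have h1 := levelCard_growth hp h0 hN hs.le hk hlt
    rw [hαp] at h1
    have h2 : k * α * (2 - y) ≤ 1 := by
      have h4 : p * (k * α * (2 - y)) ≤ p * 1 := by nlinarith
      exact le_of_mul_le_mul_left h4 hp0
    have h3 : (k * α * (2 - y)) ^ 2 ≤ 1 := by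
      have : 0 ≤ k * α * (2 - y) := mul_nonneg (by positivity) (by linarith)
      nlinarith
    have h4 : 1 ≤ 4 / 3 * (y * (2 - y) ^ 2) := by
      nlinarith [mul_nonneg (by linarith : 0 ≤ 1 - y) (by linarith : 0 ≤ y - 4 / 9),
        mul_nonneg (mul_nonneg (by linarith : 0 ≤ 1 - y) (by linarith : 0 ≤ y - 4 / 9))
          (by linarith : 0 ≤ 1 - y)]
    calc α ^ 2 = α ^ 2 * 1 := by ring
      _ ≤ α ^ 2 * (4 / 3 * (y * (2 - y) ^ 2)) := by gcongr
      _ = 4 / 3 * x * (k * α * (2 - y)) ^ 2 := by rw [hy]; ring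
      _ ≤ 4 / 3 * x * 1 := by gcongr
      _ = 4 / 3 * x := by ring

end LevelSets

/-! ### From level sets to power sums -/

theorem integral_rpow_indicator {q c : ℝ} (hq : 1 ≤ q) (hc : 0 ≤ c) (hc1 : c ≤ 1) :
    ∫ t in (0 : ℝ)..1, {t | t ≤ c}.indicator (fun t => q * t ^ (q - 1)) t = c ^ q := by
  rw [intervalIntegral.integral_indicator ⟨hc, hc1⟩, intervalIntegral.integral_const_mul,
    integral_rpow (Or.inl (by linarith))]
  rw [sub_add_cancel, Real.zero_rpow (by linarith)]
  field_simp
  ring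

theorem intervalIntegrable_const_mul_rpow {q : ℝ} (hq : 1 ≤ q) (C a b : ℝ) :
    IntervalIntegrable (fun t : ℝ => C * t ^ (q - 1)) volume a b :=
  (intervalIntegral.intervalIntegrable_rpow' (by linarith)).const_mul C

/-- Layer cake bound for power sums in terms of the sizes of the level sets. -/
theorem sum_rpow_le_of_levelCard {p : ℕ} [NeZero p] {N : ZMod p → ℝ} (hN0 : ∀ x, 0 ≤ N x)
    (hN1 : ∀ x, N x ≤ 1) {q B : ℝ} (hq : 1 ≤ q) (hB : 0 < B) {g : ℝ → ℝ}
    (hg : IntervalIntegrable g volume 0 1)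
    (hle : ∀ t ∈ Set.Ioo (0 : ℝ) 1,
      q * t ^ (q - 1) * (((levelCard N (1 - t) : ℝ) - 1) / p) ^ 2 ≤ g t)
    (hH : ∫ t in (0 : ℝ)..1, g t ≤ B ^ 2) :
    ∑ x, (1 - N x) ^ q ≤ 1 + p * B := by
  have hp0 : (0 : ℝ) < p := by exact_mod_cast NeZero.pos p
  have hint : ∀ x, IntervalIntegrable
      ({t | t ≤ 1 - N x}.indicator (fun t => q * t ^ (q - 1))) volume 0 1 := fun x => by
    have := intervalIntegrable_const_mul_rpow hq q 0 1
    rw [intervalIntegrable_iff] at this ⊢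
    exact this.indicator measurableSet_Iic
  have h1 : ∑ x, (1 - N x) ^ q = ∫ t in (0 : ℝ)..1,
      ∑ x, {t | t ≤ 1 - N x}.indicator (fun t => q * t ^ (q - 1)) t := by
    rw [intervalIntegral.integral_finsetSum fun x _ => hint x]
    refine Finset.sum_congr rfl fun x _ => ?_
    rw [integral_rpow_indicator hq (by linarith [hN1 x]) (by linarith [hN0 x])]
  have hI := intervalIntegrable_const_mul_rpow hq (q * (1 + p * B / 2)) 0 1
  have h2 : ∫ t in (0 : ℝ)..1, ∑ x, {t | t ≤ 1 - N x}.indicator (fun t => q * t ^ (q - 1)) t ≤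
      ∫ t in (0 : ℝ)..1, (q * (1 + p * B / 2) * t ^ (q - 1) + p / (2 * B) * g t) := by
    refine intervalIntegral.integral_mono_on_of_le_Ioo zero_le_one ?_ ?_ fun t ht => ?_
    · simpa only [Finset.sum_fn] using IntervalIntegrable.sum Finset.univ fun x _ => hint x
    · exact hI.add (hg.const_mul _)
    · have h3 : ∑ x, {t | t ≤ 1 - N x}.indicator (fun t => q * t ^ (q - 1)) t =
          levelCard N (1 - t) * (q * t ^ (q - 1)) := by
        simp only [Set.indicator_apply, Set.mem_ofPred_eq]
        rw [← Finset.sum_filter, Finset.sum_const, nsmul_eq_mul]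
        congr 3
        ext x
        simp only [Finset.mem_filter, Finset.mem_univ, true_and]
        constructor <;> intro h <;> linarith
      rw [h3]
      have h4 := hle t ht
      set α := ((levelCard N (1 - t) : ℝ) - 1) / p with hα
      have h5 : (levelCard N (1 - t) : ℝ) = 1 + p * α := by rw [hα]; field_simp; ring
      have hw : 0 ≤ q * t ^ (q - 1) := mul_nonneg (by linarith) (Real.rpow_nonneg ht.1.le _)
      -- Linearised Cauchy–Schwarz: against a weight of total mass 1, ∫ α² ≤ B² yields ∫ α ≤ B.
      have h6 : α ≤ B / 2 + α ^ 2 / (2 * B) := by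
        have : B / 2 + α ^ 2 / (2 * B) - α = (B - α) ^ 2 / (2 * B) := by field_simp; ring
        have : 0 ≤ (B - α) ^ 2 / (2 * B) := by positivity
        linarith
      calc (levelCard N (1 - t) : ℝ) * (q * t ^ (q - 1))
          ≤ (1 + p * (B / 2 + α ^ 2 / (2 * B))) * (q * t ^ (q - 1)) := by rw [h5]; gcongr
        _ = q * (1 + p * B / 2) * t ^ (q - 1) + p / (2 * B) * (q * t ^ (q - 1) * α ^ 2) := by
          field_simp
          ring
        _ ≤ _ := by gcongr
  rw [intervalIntegral.integral_add hI (hg.const_mul _), intervalIntegral.integral_const_mul,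
    intervalIntegral.integral_const_mul, integral_rpow (Or.inl (by linarith)), sub_add_cancel,
    Real.zero_rpow (by linarith), Real.one_rpow] at h2
  have h7 : p / (2 * B) * ∫ t in (0 : ℝ)..1, g t ≤ p / (2 * B) * B ^ 2 := by gcongr
  have h8 : p / (2 * B) * B ^ 2 = p * B / 2 := by field_simp
  have h9 : q * (1 + p * B / 2) * ((1 - 0) / q) = 1 + p * B / 2 := by field_simp; norm_num
  rw [h1]
  linarith

theorem one_sub_rpow_mul_le {m y : ℝ} (hm : 0 ≤ m) (hy0 : 0 ≤ y) (hy : y < 1) :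
    (1 - y) ^ m * (1 + m * y) ≤ 1 := by
  have h1 : (1 - y) ^ m ≤ Real.exp (-y) ^ m :=
    Real.rpow_le_rpow (by linarith) (by linarith [Real.add_one_le_exp (-y)]) hm
  rw [← Real.exp_mul] at h1
  have h2 : 1 + m * y ≤ Real.exp (m * y) := by linarith [Real.add_one_le_exp (m * y)]
  calc (1 - y) ^ m * (1 + m * y) ≤ Real.exp (-y * m) * Real.exp (m * y) := by
        gcongr
    _ = 1 := by rw [← Real.exp_add, show -y * m + m * y = 0 by ring, Real.exp_zero]

/-- Both sides vanish at 0, and the derivatives compare by the square of `one_sub_rpow_mul_le` with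
m = q/2. -/
theorem one_sub_one_sub_rpow_le {q y : ℝ} (hq : 1 ≤ q) (hy0 : 0 ≤ y) (hy : y < 1) :
    1 - (1 - y) ^ (q + 1) ≤ (q + 1) * y / (1 + q * y / 2) := by
  set φ : ℝ → ℝ := fun y => (q + 1) * y / (1 + q * y / 2) - (1 - (1 - y) ^ (q + 1)) with hφ
  have hden : ∀ y : ℝ, 0 ≤ y → 0 < 1 + q * y / 2 := fun y hy => by positivity
  have hder : ∀ x ∈ Set.Ico (0 : ℝ) 1, HasDerivAt φ
      ((q + 1) / (1 + q * x / 2) ^ 2 - (q + 1) * (1 - x) ^ q) x := by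
    intro x hx
    have hd := hden x hx.1
    have h1 : HasDerivAt (fun y : ℝ => (q + 1) * y) (q + 1) x := by
      simpa using (hasDerivAt_id x).const_mul (q + 1)
    have h2 : HasDerivAt (fun y : ℝ => 1 + q * y / 2) (q / 2) x := by
      have := (((hasDerivAt_id x).const_mul q).div_const 2).const_add 1
      simpa using this
    have h3 : HasDerivAt (fun y : ℝ => (1 - y) ^ (q + 1)) (-1 * (q + 1) * (1 - x) ^ (q + 1 - 1)) x :=
      ((hasDerivAt_id x).const_sub 1).rpow_const (Or.inr (by linarith))
    have h4 := (h1.div h2 hd.ne').sub (h3.const_sub 1)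
    refine h4.congr_deriv ?_
    rw [add_sub_cancel_right]
    field_simp
    ring
  have hmono : MonotoneOn φ (Set.Ico 0 1) := by
    refine monotoneOn_of_deriv_nonneg (convex_Ico 0 1)
      (fun x hx => (hder x hx).continuousAt.continuousWithinAt)
      (fun x hx => (hder x (interior_subset hx)).differentiableAt.differentiableWithinAt)
      fun x hx => ?_
    have hx' := interior_subset hx
    rw [(hder x hx').deriv, sub_nonneg, le_div_iff₀ (by have := hden x hx'.1; positivity)]
    have h1 := one_sub_rpow_mul_le (m := q / 2) (by linarith) hx'.1 hx'.2
    have h0 : 0 ≤ (1 - x) ^ (q / 2) * (1 + q / 2 * x) :=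
      mul_nonneg (Real.rpow_nonneg (by linarith [hx'.2]) _) (by have := hden x hx'.1; linarith)
    have h2 : ((1 - x) ^ (q / 2) * (1 + q / 2 * x)) ^ 2 ≤ 1 := by nlinarith
    have h3 : (1 - x) ^ q = ((1 - x) ^ (q / 2)) ^ 2 := by
      rw [← Real.rpow_natCast, ← Real.rpow_mul (by linarith [hx'.2])]
      congr 1; push_cast; ring
    calc (q + 1) * (1 - x) ^ q * (1 + q * x / 2) ^ 2
        = (q + 1) * ((1 - x) ^ (q / 2) * (1 + q / 2 * x)) ^ 2 := by rw [h3]; ring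
      _ ≤ (q + 1) * 1 := by gcongr
      _ = q + 1 := mul_one _
  have := hmono (⟨le_rfl, one_pos⟩) (⟨hy0, hy⟩) hy0
  simp only [hφ, mul_zero, zero_div, sub_zero, Real.one_rpow, sub_self] at this
  linarith

theorem integral_rpow_mul_one_sub {q : ℝ} (hq : 1 ≤ q) (a b : ℝ) :
    ∫ t in a..b, (t ^ (q - 1) - t ^ q) =
      (b ^ q - a ^ q) / q - (b ^ (q + 1) - a ^ (q + 1)) / (q + 1) := by
  rw [intervalIntegral.integral_sub
    (intervalIntegral.intervalIntegrable_rpow' (by linarith))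
    (intervalIntegral.intervalIntegrable_rpow' (by linarith)),
    integral_rpow (Or.inl (by linarith)), integral_rpow (Or.inl (by linarith)), sub_add_cancel]

/-- The integral of `min 1 ((1 - t) / y)` against the density `q * t ^ (q - 1)`. -/
theorem integral_rpow_mul_min_le {q y : ℝ} (hq : 1 ≤ q) (hy0 : 0 < y) (hy : y < 1) :
    ∫ t in (0 : ℝ)..1, q * t ^ (q - 1) * min 1 ((1 - t) / y) ≤ 1 / (1 + q * y / 2) := by
  have hcont : Continuous fun t : ℝ => q * t ^ (q - 1) * min 1 ((1 - t) / y) := by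
    have := Real.continuous_rpow_const (q := q - 1) (by linarith)
    fun_prop
  -- The minimum switches branch at t = 1 - y.
  rw [← intervalIntegral.integral_add_adjacent_intervals
    (hcont.intervalIntegrable 0 (1 - y)) (hcont.intervalIntegrable (1 - y) 1)]
  have h1 : ∫ t in (0 : ℝ)..(1 - y), q * t ^ (q - 1) * min 1 ((1 - t) / y) = (1 - y) ^ q := by
    rw [intervalIntegral.integral_congr (g := fun t => q * t ^ (q - 1)),
      intervalIntegral.integral_const_mul, integral_rpow (Or.inl (by linarith)), sub_add_cancel,
      Real.zero_rpow (by linarith)]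
    · field_simp; simp
    · intro t ht
      rw [Set.uIcc_of_le (by linarith)] at ht
      beta_reduce
      rw [min_eq_left, mul_one]
      rw [le_div_iff₀ hy0]; linarith [ht.2]
  have h2 : ∫ t in (1 - y)..1, q * t ^ (q - 1) * min 1 ((1 - t) / y) =
      q / y * ((1 ^ q - (1 - y) ^ q) / q - (1 ^ (q + 1) - (1 - y) ^ (q + 1)) / (q + 1)) := by
    rw [← integral_rpow_mul_one_sub hq, ← intervalIntegral.integral_const_mul]
    refine intervalIntegral.integral_congr fun t ht => ?_
    rw [Set.uIcc_of_le (by linarith)] at ht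
    have ht0 : 0 < t := by linarith [ht.1]
    rw [min_eq_right (by rw [div_le_one hy0]; linarith [ht.1])]
    have : t ^ q = t ^ (q - 1) * t := by
      rw [← Real.rpow_add_one ht0.ne', sub_add_cancel]
    rw [this]; field_simp
  rw [h1, h2]
  have h3 := one_sub_one_sub_rpow_le hq hy0.le hy
  have h4 : (1 - y) ^ (q + 1) = (1 - y) ^ q * (1 - y) := Real.rpow_add_one (by linarith) q
  have h5 : (1 - y) ^ q + q / y * ((1 ^ q - (1 - y) ^ q) / q -
      (1 ^ (q + 1) - (1 - y) ^ (q + 1)) / (q + 1)) =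
      (1 - (1 - y) ^ (q + 1)) / ((q + 1) * y) := by
    rw [Real.one_rpow, Real.one_rpow, h4]
    have : q + 1 ≠ 0 := by linarith
    field_simp
    ring
  rw [h5, div_le_iff₀ (by positivity)]
  calc _ ≤ _ := h3
    _ = _ := by ring

/-- Power sums of `1 - N` for a negative definite function `N` on `ZMod p`. -/
theorem sum_one_sub_rpow_le {p : ℕ} [NeZero p] (hp : p.Prime) {N : ZMod p → ℝ} (h0 : N 0 = 0)
    (hN : ∀ k : ℕ, 1 ≤ k → ∀ x y, N (x + y) ≤ (1 + 1 / (k : ℝ)) * N x + (1 + k) * N y)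
    (hN0 : ∀ x, 0 ≤ N x) (hN1 : ∀ x, N x ≤ 1) {d M : ℝ} (hNd : ∀ x, N x ≤ 2 * d)
    (hsum : p * d ≤ ∑ x, N x) (hM0 : 0 < M) (hM1 : M < 1) (hd : 1 - M ≤ d) {q : ℝ}
    (hq : 11 ≤ q) :
    ∑ x, (1 - N x) ^ q ≤ 1 + p * (√(1 + q * (M ^ (-2 : ℤ) - 1) / 11))⁻¹ := by
  have hp0 : (0 : ℝ) < p := by exact_mod_cast hp.pos
  have hM2 : M ^ 2 < 1 := by nlinarith
  have hMM : M ^ (-2 : ℤ) = 1 / M ^ 2 := by rw [zpow_neg, one_div]; rfl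
  set E := 1 + q * (M ^ (-2 : ℤ) - 1) / 11 with hE
  have hE' : E = (M ^ 2 + q * (1 - M ^ 2) / 11) / M ^ 2 := by rw [hE, hMM]; field_simp
  have hnum : 0 < M ^ 2 + q * (1 - M ^ 2) / 11 := by
    have : 0 < q * (1 - M ^ 2) := mul_pos (by linarith) (by linarith)
    positivity
  have hE0 : 0 < E := by rw [hE']; positivity
  have hB2 : ((√E)⁻¹) ^ 2 = M ^ 2 / (M ^ 2 + q * (1 - M ^ 2) / 11) := by
    rw [inv_pow, Real.sq_sqrt hE0.le, hE', inv_div]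
  have hB0 : 0 < (√E)⁻¹ := by positivity
  have hpow : ∀ {t : ℝ} (r : ℝ), 0 < t → t ^ (r + 1) = t ^ r * t := fun r ht =>
    Real.rpow_add_one ht.ne' r
  by_cases hM : M ≤ 1 / 2
  · refine sum_rpow_le_of_levelCard hN0 hN1 (by linarith) hB0
      (g := fun t => 8 * M ^ 2 * q * (t ^ (q - 2 - 1) - t ^ (q - 2))) ?_ ?_ ?_
    · exact ((intervalIntegral.intervalIntegrable_rpow' (by linarith)).sub
        (intervalIntegral.intervalIntegrable_rpow' (by linarith))).const_mul _
    · intro t ht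
      have h1 := levelCard_bound_of_le_half hp h0 hN hN1 hM
        (le_trans (by gcongr) hsum) (s := 1 - t) (by linarith [ht.2]) (by linarith [ht.1])
      have ht0 := ht.1
      have h2 : t ^ (q - 2) = t ^ (q - 2 - 1) * t := by rw [← hpow _ ht0, sub_add_cancel]
      have h3 : t ^ (q - 1) = t ^ (q - 2 - 1) * t * t := by
        rw [← h2, ← hpow _ ht0]; congr 1; ring
      have hq0 : 0 ≤ q * t ^ (q - 1) := mul_nonneg (by linarith) (Real.rpow_nonneg ht0.le _)
      calc _ ≤ q * t ^ (q - 1) * (8 * M ^ 2 * ((1 - t) / (1 - (1 - t)) ^ 2)) := by gcongr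
        _ = _ := by
          rw [h2, h3, sub_sub_cancel]; field_simp
    · rw [intervalIntegral.integral_const_mul, integral_rpow_mul_one_sub (by linarith),
        Real.one_rpow, Real.one_rpow, Real.zero_rpow (by linarith), Real.zero_rpow (by linarith),
        hB2, le_div_iff₀ hnum]
      have h2 : q - 2 ≠ 0 := by linarith
      have h3 : q - 2 + 1 ≠ 0 := by linarith
      have h4 : 8 * M ^ 2 * q * ((1 - 0) / (q - 2) - (1 - 0) / (q - 2 + 1)) *
          (M ^ 2 + q * (1 - M ^ 2) / 11) =
          M ^ 2 * (8 * q * (M ^ 2 + q * (1 - M ^ 2) / 11) / ((q - 2) * (q - 1))) := by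
        have : q - 1 ≠ 0 := by linarith
        have h5 : q - 2 + 1 = q - 1 := by ring
        rw [h5]
        field_simp
        ring
      rw [h4]
      refine mul_le_of_le_one_right (by positivity) ?_
      rw [div_le_one (mul_pos (by linarith) (by linarith))]
      -- The constant 11 is nearly forced here: 8q²/11 ≤ (q - 1)(q - 2) reads 88 ≤ 90 at q = 11.
      have h5 : M ^ 2 + q * (1 - M ^ 2) / 11 ≤ q / 11 := by nlinarith [sq_nonneg M]
      have h6 : 8 * q * (M ^ 2 + q * (1 - M ^ 2) / 11) ≤ 8 * q * (q / 11) := by gcongr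
      nlinarith
  push Not at hM
  have hδ : 0 < 1 - M := by linarith
  have hlev : ∀ t ∈ Set.Ioo (0 : ℝ) 1,
      (((levelCard N (1 - t) : ℝ) - 1) / p) ^ 2 ≤ min 1 (4 / (3 * (1 - M)) * (1 - t)) :=
    fun t ht => levelCard_bound hp h0 hN hδ hd hNd hsum (by linarith [ht.2])
  by_cases hM23 : M ≤ 2 / 3
  · refine sum_rpow_le_of_levelCard hN0 hN1 (by linarith) hB0
      (g := fun t => 4 / (3 * (1 - M)) * q * (t ^ (q - 1) - t ^ q)) ?_ ?_ ?_
    · exact ((intervalIntegral.intervalIntegrable_rpow' (by linarith)).sub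
        (intervalIntegral.intervalIntegrable_rpow' (by linarith))).const_mul _
    · intro t ht
      have h1 := (hlev t ht).trans (min_le_right _ _)
      have ht0 := ht.1
      have h2 : t ^ q = t ^ (q - 1) * t := by rw [← hpow _ ht0, sub_add_cancel]
      have hq0 : 0 ≤ q * t ^ (q - 1) := mul_nonneg (by linarith) (Real.rpow_nonneg ht0.le _)
      calc _ ≤ q * t ^ (q - 1) * (4 / (3 * (1 - M)) * (1 - t)) := by gcongr
        _ = _ := by rw [h2]; ring
    · rw [intervalIntegral.integral_const_mul, integral_rpow_mul_one_sub (by linarith),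
        Real.one_rpow, Real.one_rpow, Real.zero_rpow (by linarith), Real.zero_rpow (by linarith),
        hB2, le_div_iff₀ hnum]
      have h4 : 4 / (3 * (1 - M)) * q * ((1 - 0) / q - (1 - 0) / (q + 1)) *
          (M ^ 2 + q * (1 - M ^ 2) / 11) =
          4 * (M ^ 2 + q * (1 - M ^ 2) / 11) / (3 * (1 - M) * (q + 1)) := by
        have : q ≠ 0 := by linarith
        have : q + 1 ≠ 0 := by linarith
        field_simp
        ring
      rw [h4, div_le_iff₀ (mul_pos (by linarith) (by linarith))]
      -- The required inequality is affine in q: `h5` is its case q = 11, and `h6` compares the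
      -- slopes.
      have h5 : 1 / 9 ≤ M ^ 2 * (1 - M) := by
        nlinarith [mul_nonneg (by linarith : 0 ≤ M - 1 / 2) (by linarith : 0 ≤ 2 / 3 - M),
          mul_nonneg (mul_nonneg (by linarith : 0 ≤ M - 1 / 2) (by linarith : 0 ≤ 2 / 3 - M)) hM0.le]
      have h6 : 4 / 11 * (1 - M ^ 2) ≤ 3 * (M ^ 2 * (1 - M)) := by
        have : 4 / 11 * (1 + M) ≤ 3 * M ^ 2 := by nlinarith
        nlinarith
      nlinarith [mul_nonneg (by linarith : 0 ≤ q - 11) (by linarith :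
        0 ≤ 3 * (M ^ 2 * (1 - M)) - 4 / 11 * (1 - M ^ 2))]
  · push Not at hM23
    -- As M → 1 the bound 4(1 - t)/(3(1 - M)) blows up, so the minimum with 1 must be kept.
    have hy : 0 < 3 * (1 - M) / 4 := by linarith
    refine sum_rpow_le_of_levelCard hN0 hN1 (by linarith) hB0
      (g := fun t => q * t ^ (q - 1) * min 1 ((1 - t) / (3 * (1 - M) / 4))) ?_ ?_ ?_
    · have := Real.continuous_rpow_const (q := q - 1) (by linarith)
      exact Continuous.intervalIntegrable (by fun_prop) _ _
    · intro t ht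
      have h1 := hlev t ht
      have hq0 : 0 ≤ q * t ^ (q - 1) := mul_nonneg (by linarith) (Real.rpow_nonneg ht.1.le _)
      have h2 : (1 - t) / (3 * (1 - M) / 4) = 4 / (3 * (1 - M)) * (1 - t) := by
        field_simp
      rw [h2]
      gcongr
    · refine (integral_rpow_mul_min_le (by linarith) hy (by linarith)).trans ?_
      have h4 : 0 < q * (3 * (1 - M) / 4) := mul_pos (by linarith) hy
      rw [hB2, div_le_div_iff₀ (by linarith) hnum]
      have h5 : (1 + M) / 11 ≤ M ^ 2 * (3 / 8) := by nlinarith [sq_nonneg (M - 2 / 3)]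
      have h6 := mul_le_mul_of_nonneg_left h5 (mul_nonneg (by linarith : 0 ≤ q) hδ.le)
      linarith

/-! ### Fourier transforms of probability vectors on `ZMod p` -/

section Fourier

variable {p : ℕ} [NeZero p]

/-- On the unit circle 1 - Re z = |1 - z|²/2, and |1 - χ| is subadditive. -/
theorem one_sub_re_add_le (χ : AddChar (ZMod p) ℂ) {k : ℕ} (hk : 1 ≤ k) (x y : ZMod p) :
    1 - (χ (x + y)).re ≤ (1 + 1 / (k : ℝ)) * (1 - (χ x).re) + (1 + k) * (1 - (χ y).re) := by
  have hk0 : (0 : ℝ) < k := by exact_mod_cast hk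
  have key : ∀ z, 1 - (χ z).re = ‖1 - χ z‖ ^ 2 / 2 := fun z => by
    have h1 : ‖χ z‖ ^ 2 = 1 := by rw [AddChar.norm_apply]; norm_num
    rw [Complex.sq_norm, Complex.normSq_apply] at h1 ⊢
    simp only [Complex.sub_re, Complex.sub_im, Complex.one_re, Complex.one_im]
    linarith
  have h2 : ‖1 - χ (x + y)‖ ≤ ‖1 - χ x‖ + ‖1 - χ y‖ := by
    have : 1 - χ (x + y) = (1 - χ x) + χ x * (1 - χ y) := by
      rw [AddChar.map_add_eq_mul]; ring
    rw [this]
    refine (norm_add_le _ _).trans ?_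
    rw [norm_mul, AddChar.norm_apply, one_mul]
  rw [key, key, key]
  set a := ‖1 - χ x‖
  set b := ‖1 - χ y‖
  have h3 : ‖1 - χ (x + y)‖ ^ 2 ≤ (a + b) ^ 2 := by gcongr
  have h4 : (1 + 1 / (k : ℝ)) * a ^ 2 + (1 + k) * b ^ 2 - (a + b) ^ 2 = (a - k * b) ^ 2 / k := by
    field_simp; ring
  have h5 : 0 ≤ (a - k * b) ^ 2 / k := by positivity
  linarith

/-- One minus the squared modulus of the Fourier transform of a probability vector `w`. -/
noncomputable def fourierDefect (w : ZMod p → ℝ) (j : ZMod p) : ℝ :=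
  ∑ r, ∑ r', w r * w r' * (1 - (ZMod.stdAddChar (j * (r - r')) : ℂ).re)

theorem sq_norm_fourier_eq {w : ZMod p → ℝ} (hw : ∑ r, w r = 1) (j : ZMod p) :
    ‖∑ r, (w r : ℂ) * ZMod.stdAddChar (j * r)‖ ^ 2 = 1 - fourierDefect w j := by
  have h1 : fourierDefect w j =
      1 - ∑ r, ∑ r', w r * w r' * (ZMod.stdAddChar (j * (r - r')) : ℂ).re := by
    unfold fourierDefect
    simp only [mul_sub, mul_one, Finset.sum_sub_distrib]
    congr 1
    simp only [← Finset.mul_sum, hw, mul_one]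
  rw [h1, sub_sub_cancel]
  have h2 : ((‖∑ r, (w r : ℂ) * ZMod.stdAddChar (j * r)‖ ^ 2 : ℝ) : ℂ) =
      ∑ r, ∑ r', ((w r * w r' : ℝ) : ℂ) * ZMod.stdAddChar (j * (r - r')) := by
    push_cast
    rw [← Complex.mul_conj', map_sum, Finset.sum_mul_sum]
    refine Finset.sum_congr rfl fun r _ => Finset.sum_congr rfl fun r' _ => ?_
    rw [map_mul (starRingEnd ℂ), Complex.conj_ofReal, ← AddChar.map_neg_eq_conj, mul_sub, sub_eq_add_neg,
      AddChar.map_add_eq_mul]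
    ring
  have h3 := congrArg Complex.re h2
  rw [Complex.ofReal_re] at h3
  rw [h3]
  simp only [Complex.re_sum, Complex.re_ofReal_mul]

theorem fourierDefect_zero (w : ZMod p → ℝ) : fourierDefect w 0 = 0 := by
  simp [fourierDefect]

theorem fourierDefect_add_le {w : ZMod p → ℝ} (hw0 : ∀ r, 0 ≤ w r) {k : ℕ} (hk : 1 ≤ k)
    (x y : ZMod p) : fourierDefect w (x + y) ≤
      (1 + 1 / (k : ℝ)) * fourierDefect w x + (1 + k) * fourierDefect w y := by
  unfold fourierDefect
  simp only [Finset.mul_sum, ← Finset.sum_add_distrib]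
  refine Finset.sum_le_sum fun r _ => Finset.sum_le_sum fun r' _ => ?_
  rw [add_mul]
  have := mul_le_mul_of_nonneg_left
    (one_sub_re_add_le ZMod.stdAddChar hk (x * (r - r')) (y * (r - r')))
    (mul_nonneg (hw0 r) (hw0 r'))
  linarith

theorem fourierDefect_nonneg {w : ZMod p → ℝ} (hw0 : ∀ r, 0 ≤ w r) (x : ZMod p) :
    0 ≤ fourierDefect w x := by
  refine Finset.sum_nonneg fun r _ => Finset.sum_nonneg fun r' _ =>
    mul_nonneg (mul_nonneg (hw0 r) (hw0 r')) ?_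
  have := Complex.re_le_norm (ZMod.stdAddChar (x * (r - r')) : ℂ)
  rw [AddChar.norm_apply] at this
  linarith

theorem sum_sum_mul_offDiag {w : ZMod p → ℝ} (hw : ∑ r, w r = 1) (c : ℝ) :
    ∑ r, ∑ r', w r * w r' * (c - if r = r' then c else 0) = c * (1 - ∑ r, w r ^ 2) := by
  simp only [mul_sub, Finset.sum_sub_distrib, mul_ite, mul_zero, Finset.sum_ite_eq,
    Finset.mem_univ, if_true, ← Finset.sum_mul, ← Finset.mul_sum, hw, mul_one, one_mul,
    mul_comm c, pow_two]
  ring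

theorem fourierDefect_le {w : ZMod p → ℝ} (hw0 : ∀ r, 0 ≤ w r) (hw : ∑ r, w r = 1)
    (x : ZMod p) : fourierDefect w x ≤ 2 * (1 - ∑ r, w r ^ 2) := by
  rw [← sum_sum_mul_offDiag hw]
  refine Finset.sum_le_sum fun r _ => Finset.sum_le_sum fun r' _ =>
    mul_le_mul_of_nonneg_left ?_ (mul_nonneg (hw0 r) (hw0 r'))
  split_ifs with h
  · simp [h]
  · have := Complex.abs_re_le_norm (ZMod.stdAddChar (x * (r - r')) : ℂ)
    rw [AddChar.norm_apply] at this
    linarith [(abs_le.mp this).1]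

/-- By orthogonality of characters, averaging over frequencies replaces the cosine by the indicator
of r = r'. -/
theorem sum_fourierDefect {w : ZMod p → ℝ} (hw : ∑ r, w r = 1) :
    ∑ x, fourierDefect w x = p * (1 - ∑ r, w r ^ 2) := by
  rw [← sum_sum_mul_offDiag hw]
  unfold fourierDefect
  rw [Finset.sum_comm]
  refine Finset.sum_congr rfl fun r _ => ?_
  rw [Finset.sum_comm]
  refine Finset.sum_congr rfl fun r' _ => ?_
  rw [← Finset.mul_sum]
  congr 1
  have h := congrArg Complex.re
    (AddChar.sum_mulShift (r - r') (ZMod.isPrimitive_stdAddChar p))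
  rw [Complex.re_sum] at h
  rw [Finset.sum_sub_distrib, h]
  simp only [sub_eq_zero]
  split_ifs <;> simp [ZMod.card]

/-- High moments of the Fourier transform of a probability vector on `ZMod p` all of whose
entries are at most `M`. -/
theorem sum_norm_fourier_rpow_le (hp : p.Prime) {w : ZMod p → ℝ} (hw0 : ∀ r, 0 ≤ w r)
    (hw : ∑ r, w r = 1) {M : ℝ} (hM0 : 0 < M) (hM1 : M < 1) (hwM : ∀ r, w r ≤ M) {q : ℝ}
    (hq : 11 ≤ q) :
    ∑ j, (‖∑ r, (w r : ℂ) * ZMod.stdAddChar (j * r)‖ ^ 2) ^ q ≤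
      1 + p * (√(1 + q * (M ^ (-2 : ℤ) - 1) / 11))⁻¹ := by
  simp only [sq_norm_fourier_eq hw]
  refine sum_one_sub_rpow_le hp (fourierDefect_zero w)
    (fun k hk x y => fourierDefect_add_le hw0 hk x y) (fourierDefect_nonneg hw0) (fun x => ?_)
    (fourierDefect_le hw0 hw) (sum_fourierDefect hw).ge hM0 hM1 ?_ hq
  · have := sq_norm_fourier_eq hw x
    have h2 := sq_nonneg ‖∑ r, (w r : ℂ) * ZMod.stdAddChar (x * r)‖
    linarith
  · have : ∑ r, w r ^ 2 ≤ ∑ r, w r * M := Finset.sum_le_sum fun r _ => by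
      rw [pow_two]; exact mul_le_mul_of_nonneg_left (hwM r) (hw0 r)
    rw [← Finset.sum_mul, hw] at this
    linarith

end Fourier

theorem AddChar.map_finsetSum {A M ι : Type*} [AddCommMonoid A] [CommMonoid M] (ψ : AddChar A M)
    (s : Finset ι) (f : ι → A) : ψ (∑ i ∈ s, f i) = ∏ i ∈ s, ψ (f i) :=
  map_prod ψ.toMonoidHom (fun i => Multiplicative.ofAdd (f i)) s

/-! ### Concentration of integer-valued variables -/

section Probability

variable {Ω : Type*} [MeasurableSpace Ω] {P : Measure Ω} [IsProbabilityMeasure P]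

theorem measurableSet_fiber {X : Ω → ℤ} (hX : Measurable X) {α : Type*} (g : ℤ → α) (a : α) :
    MeasurableSet {ω | g (X ω) = a} :=
  hX (MeasurableSet.of_discrete (s := {k | g k = a}))

theorem le_maxProb (X : Ω → ℤ) (k : ℤ) : P.real {ω | X ω = k} ≤ maxProb P X :=
  le_ciSup (f := fun k : ℤ => P.real {ω | X ω = k})
    ⟨1, by rintro _ ⟨k, rfl⟩; exact measureReal_le_one⟩ k

theorem maxProb_le_one (X : Ω → ℤ) : maxProb P X ≤ 1 :=
  ciSup_le fun _ => measureReal_le_one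

theorem maxProb_pos (X : Ω → ℤ) : 0 < maxProb P X := by
  by_contra! h
  have h0 : ∀ k : ℤ, P {ω | X ω = k} = 0 := fun k => by
    have := (le_maxProb (P := P) X k).trans h
    exact (measureReal_eq_zero_iff).mp (le_antisymm this measureReal_nonneg)
  have h1 : P (⋃ k : ℤ, {ω | X ω = k}) = 0 := measure_iUnion_null h0
  have h2 : (⋃ k : ℤ, {ω | X ω = k}) = Set.univ := by ext ω; simp
  rw [h2, measure_univ] at h1
  exact one_ne_zero h1

theorem deltaInfty_eq {Ω : Type*} [MeasurableSpace Ω] (P : Measure Ω) (X : Ω → ℤ) :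
    deltaInfty P X = (maxProb P X ^ 2)⁻¹ - 1 := by
  rw [deltaInfty, zpow_neg, zpow_ofNat]

theorem deltaInfty_nonneg (X : Ω → ℤ) : 0 ≤ deltaInfty P X := by
  have h0 := maxProb_pos (P := P) X
  have h1 := maxProb_le_one (P := P) X
  have : 1 ≤ (maxProb P X ^ 2)⁻¹ := (one_le_inv₀ (by positivity)).mpr (by nlinarith)
  rw [deltaInfty_eq]
  exact sub_nonneg.mpr this

theorem deltaInfty_eq_zero_of_not_lt {X : Ω → ℤ} (h : ¬ maxProb P X < 1) :
    deltaInfty P X = 0 := by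
  have : maxProb P X = 1 := le_antisymm (maxProb_le_one X) (not_lt.mp h)
  simp [deltaInfty, this]

theorem le_deltaInfty_of_maxProb_le {X : Ω → ℤ} {c : ℝ} (hc : 0 ≤ c)
    (h : maxProb P X ≤ (√(1 + c))⁻¹) : c ≤ deltaInfty P X := by
  have h0 := maxProb_pos (P := P) X
  have hs : 0 < √(1 + c) := by positivity
  have h1 : √(1 + c) ≤ (maxProb P X)⁻¹ := by
    rw [le_inv_comm₀ hs h0]; exact h
  have h2 : √(1 + c) ^ 2 ≤ (maxProb P X)⁻¹ ^ 2 := by gcongr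
  rw [Real.sq_sqrt (by linarith), inv_pow] at h2
  rw [deltaInfty_eq]
  linarith

theorem deltaInfty_anti {X Y : Ω → ℤ} (h : maxProb P Y ≤ maxProb P X) :
    deltaInfty P X ≤ deltaInfty P Y := by
  have h0 := maxProb_pos (P := P) Y
  rw [deltaInfty_eq, deltaInfty_eq]
  gcongr

/-- Condition on Y: P(X + Y = k) is an average of the atoms P(X = k - j). -/
theorem maxProb_add_le {X Y : Ω → ℤ} (hY : Measurable Y)
    (h : IndepFun X Y P) : maxProb P (fun ω => X ω + Y ω) ≤ maxProb P X := by
  refine ciSup_le fun k => ?_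
  have h1 : {ω | X ω + Y ω = k} = ⋃ j : ℤ, (X ⁻¹' {k - j} ∩ Y ⁻¹' {j}) := by
    ext ω
    simp only [Set.mem_ofPred_eq, Set.mem_iUnion, Set.mem_inter_iff, Set.mem_preimage,
      Set.mem_singleton_iff]
    constructor
    · intro h; exact ⟨Y ω, by omega, rfl⟩
    · rintro ⟨j, h1, h2⟩; omega
  have h2 : P {ω | X ω + Y ω = k} ≤ ENNReal.ofReal (maxProb P X) := by
    rw [h1]
    refine (measure_iUnion_le _).trans ?_
    calc ∑' j : ℤ, P (X ⁻¹' {k - j} ∩ Y ⁻¹' {j})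
        ≤ ∑' j : ℤ, ENNReal.ofReal (maxProb P X) * P (Y ⁻¹' {j}) := by
          refine ENNReal.tsum_le_tsum fun j => ?_
          rw [h.measure_inter_preimage_eq_mul _ _ (MeasurableSet.singleton _)
            (MeasurableSet.singleton _)]
          gcongr
          rw [ENNReal.le_ofReal_iff_toReal_le (measure_ne_top _ _) (maxProb_pos X).le]
          exact le_maxProb X (k - j)
      _ = ENNReal.ofReal (maxProb P X) * ∑' j : ℤ, P (Y ⁻¹' {j}) := ENNReal.tsum_mul_left
      _ = ENNReal.ofReal (maxProb P X) * 1 := by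
          congr 1
          rw [← measure_iUnion, ← Set.preimage_iUnion, Set.iUnion_of_singleton, Set.preimage_univ,
            measure_univ]
          · intro i j hij
            exact Disjoint.preimage _ (by simpa using hij)
          · exact fun j => hY (MeasurableSet.singleton _)
      _ = _ := mul_one _
  exact ENNReal.toReal_le_of_le_ofReal (maxProb_pos X).le h2

theorem maxProb_sum_le {ι : Type*} [Fintype ι] {X : ι → Ω → ℤ} (hX : ∀ i, Measurable (X i))
    (h : iIndepFun X P) (i : ι) : maxProb P (fun ω => ∑ i, X i ω) ≤ maxProb P (X i) := by
  classical
  have h1 := (h.indepFun_finsetSum_of_notMem hX (Finset.notMem_erase i Finset.univ)).symm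
  have h2 := maxProb_add_le (X := X i) (Y := ∑ j ∈ Finset.univ.erase i, X j)
    (by fun_prop) h1
  convert h2 using 3 with ω
  rw [Finset.sum_apply, Finset.add_sum_erase _ (fun j => X j ω) (Finset.mem_univ i)]

/-- A residue class contains at most one integer of modulus below p/2, so off the tail event it is
at most a single atom. -/
theorem residueProb_le {X : Ω → ℤ} (p : ℕ) [NeZero p] (r : ZMod p) :
    P.real {ω | (X ω : ZMod p) = r} ≤ maxProb P X + P.real {ω | (p : ℤ) ≤ 2 * |X ω|} := by
  have h1 : {ω | (X ω : ZMod p) = r} ⊆ {ω | X ω = r.valMinAbs} ∪ {ω | (p : ℤ) ≤ 2 * |X ω|} := by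
    intro ω hω
    simp only [Set.mem_ofPred_eq] at hω
    by_cases h : (p : ℤ) ≤ 2 * |X ω|
    · exact Or.inr h
    · refine Or.inl ?_
      simp only [Set.mem_ofPred_eq]
      push Not at h
      refine ((ZMod.valMinAbs_spec _ _).mpr ⟨hω.symm, ?_⟩).symm
      have := abs_lt.mp (by rwa [abs_mul, abs_two] : |2 * X ω| < (p : ℤ))
      constructor <;> linarith [this.1, this.2]
  calc _ ≤ P.real ({ω | X ω = r.valMinAbs} ∪ {ω | (p : ℤ) ≤ 2 * |X ω|}) := measureReal_mono h1
    _ ≤ _ := measureReal_union_le _ _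
    _ ≤ _ := by gcongr; exact le_maxProb X _

theorem tendsto_tailProb {X : Ω → ℤ} (hX : Measurable X) :
    Filter.Tendsto (fun p : ℕ => P.real {ω | (p : ℤ) ≤ 2 * |X ω|}) Filter.atTop (nhds 0) := by
  have h1 : Filter.Tendsto (fun p : ℕ => P {ω | (p : ℤ) ≤ 2 * |X ω|}) Filter.atTop
      (nhds (P (⋂ p : ℕ, {ω | (p : ℤ) ≤ 2 * |X ω|}))) := by
    refine tendsto_measure_iInter_atTop (fun p => ?_) (fun m n hmn ω hω => ?_)
      ⟨0, measure_ne_top _ _⟩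
    · exact (hX (MeasurableSet.of_discrete (s := {k : ℤ | (p : ℤ) ≤ 2 * |k|}))).nullMeasurableSet
    · simp only [Set.mem_ofPred_eq] at hω ⊢
      have : (m : ℤ) ≤ n := by exact_mod_cast hmn
      linarith
  have h2 : (⋂ p : ℕ, {ω | (p : ℤ) ≤ 2 * |X ω|}) = ∅ := by
    ext ω
    simp only [Set.mem_iInter, Set.mem_ofPred_eq, Set.mem_empty_iff_false, iff_false, not_forall,
      not_le]
    refine ⟨(2 * |X ω| + 1).toNat, ?_⟩
    have := abs_nonneg (X ω)
    omega
  rw [h2, measure_empty] at h1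
  exact (ENNReal.tendsto_toReal ENNReal.zero_ne_top).comp h1

/-! ### Characteristic functions modulo `p` -/

theorem integral_comp_zmod {p : ℕ} [NeZero p] {X : Ω → ℤ} (hX : Measurable X) (g : ZMod p → ℂ) :
    ∫ ω, g (X ω) ∂P = ∑ r, (P.real {ω | (X ω : ZMod p) = r} : ℂ) * g r := by
  have h1 : ∀ ω, g (X ω) =
      ∑ r, {ω | (X ω : ZMod p) = r}.indicator (fun _ => g r) ω := fun ω => by
    simp [Set.indicator_apply]
  have hm := fun r : ZMod p => measurableSet_fiber hX (fun k : ℤ => (k : ZMod p)) r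
  simp only [h1]
  rw [integral_finsetSum _ fun r _ => (integrable_const _).indicator (hm r)]
  refine Finset.sum_congr rfl fun r _ => ?_
  rw [integral_indicator_const _ (hm r), Complex.real_smul]

theorem sum_residueProb {p : ℕ} [NeZero p] {X : Ω → ℤ} (hX : Measurable X) :
    ∑ r : ZMod p, P.real {ω | (X ω : ZMod p) = r} = 1 := by
  have h := integral_comp_zmod (P := P) (p := p) hX fun _ => 1
  simp only [integral_const, probReal_univ, one_smul, mul_one] at h
  exact_mod_cast h.symm

/-- Enlarge the event to a congruence mod p, invert the Fourier transform, and factor by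
independence. -/
theorem prob_sum_le {ι : Type*} [Fintype ι] {X : ι → Ω → ℤ} (hX : ∀ i, Measurable (X i))
    (h : iIndepFun X P) (p : ℕ) [NeZero p] (k : ℤ) :
    P.real {ω | ∑ i, X i ω = k} ≤
      (∑ j : ZMod p, ∏ i, ‖∫ ω, (ZMod.stdAddChar (j * (X i ω : ZMod p)) : ℂ) ∂P‖) / p := by
  have hp0 : (0 : ℝ) < p := by exact_mod_cast NeZero.pos p
  have hS : Measurable fun ω => ∑ i, X i ω := Finset.measurable_fun_sum _ fun i _ => hX i
  have h1 : P.real {ω | ∑ i, X i ω = k} ≤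
      P.real {ω | ((∑ i, X i ω : ℤ) : ZMod p) = (k : ZMod p)} :=
    measureReal_mono fun ω (hω : _ = k) => congrArg (Int.cast : ℤ → ZMod p) hω
  refine h1.trans ?_
  rw [le_div_iff₀ hp0]
  have h2 : ((P.real {ω | ((∑ i, X i ω : ℤ) : ZMod p) = (k : ZMod p)} * p : ℝ) : ℂ) =
      ∫ ω, ∑ j : ZMod p, (ZMod.stdAddChar (j * (((∑ i, X i ω : ℤ) : ZMod p) - (k : ZMod p))) : ℂ) ∂P := by
    rw [integral_comp_zmod hS
      fun r => ∑ j : ZMod p, (ZMod.stdAddChar (j * (r - (k : ZMod p))) : ℂ)]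
    simp only [AddChar.sum_mulShift _ (ZMod.isPrimitive_stdAddChar p), sub_eq_zero]
    simp [ZMod.card]
  have hmeas : ∀ g : ℤ → ℂ, Measurable g := fun g => measurable_from_top
  have h3 : ∀ j : ZMod p,
      ∫ ω, (ZMod.stdAddChar (j * (((∑ i, X i ω : ℤ) : ZMod p) - (k : ZMod p))) : ℂ) ∂P =
      ZMod.stdAddChar (-(j * (k : ZMod p))) * ∏ i, ∫ ω, (ZMod.stdAddChar (j * (X i ω : ZMod p)) : ℂ) ∂P := by
    intro j
    have h4 := h.integral_fun_prod_comp (fun i => (hX i).aemeasurable)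
      (f := fun _ (m : ℤ) => (ZMod.stdAddChar (j * (m : ZMod p)) : ℂ))
      (fun i => (hmeas _).aestronglyMeasurable)
    rw [← h4, ← integral_const_mul]
    congr 1
    ext ω
    rw [mul_sub, sub_eq_add_neg, AddChar.map_add_eq_mul, mul_comm, Int.cast_sum, Finset.mul_sum,
      AddChar.map_finsetSum]
  rw [integral_finsetSum] at h2
  · simp only [h3] at h2
    have h5 := congrArg norm h2
    rw [Complex.norm_real, Real.norm_of_nonneg (by positivity)] at h5
    rw [h5]
    refine (norm_sum_le _ _).trans (Finset.sum_le_sum fun j _ => ?_)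
    rw [norm_mul, AddChar.norm_apply, one_mul, norm_prod]
  · intro j _
    refine Integrable.of_bound (C := 1)
      ((hmeas fun m => (ZMod.stdAddChar (j * ((m : ZMod p) - (k : ZMod p))) : ℂ)).comp hS).aestronglyMeasurable
      (Filter.Eventually.of_forall fun ω => ?_)
    rw [AddChar.norm_apply]

theorem norm_integral_stdAddChar_le_one {p : ℕ} [NeZero p] (X : Ω → ℤ) (j : ZMod p) :
    ‖∫ ω, (ZMod.stdAddChar (j * (X ω : ZMod p)) : ℂ) ∂P‖ ≤ 1 := by
  refine (norm_integral_le_of_norm_le_const (C := 1)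
    (Filter.Eventually.of_forall fun ω => ?_)).trans (by simp)
  rw [AddChar.norm_apply]

/-- The average of a high power of the Fourier transform of `X` modulo `p`. -/
theorem sum_norm_integral_rpow_le {p : ℕ} [NeZero p] (hp : p.Prime) {X : Ω → ℤ}
    (hX : Measurable X) {q : ℝ} (hq : 11 ≤ q)
    (hM : maxProb P X + P.real {ω | (p : ℤ) ≤ 2 * |X ω|} < 1) :
    ∑ j : ZMod p, (‖∫ ω, (ZMod.stdAddChar (j * (X ω : ZMod p)) : ℂ) ∂P‖ ^ 2) ^ q ≤
      1 + p * (√(1 + q * ((maxProb P X + P.real {ω | (p : ℤ) ≤ 2 * |X ω|}) ^ (-2 : ℤ) - 1) / 11))⁻¹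
      := by
  have h1 := fun j : ZMod p =>
    integral_comp_zmod (P := P) hX fun r : ZMod p => (ZMod.stdAddChar (j * r) : ℂ)
  simp only [h1]
  exact sum_norm_fourier_rpow_le hp (fun _ => measureReal_nonneg) (sum_residueProb hX)
    (add_pos_of_pos_of_nonneg (maxProb_pos X) measureReal_nonneg) hM (fun r => residueProb_le p r)
    hq

/-! ### Combining the summands -/

/-- Weighted arithmetic-geometric mean bound in which the factors of weight zero are at most one. -/
theorem prod_le_sum_mul_rpow {ι : Type*} [Fintype ι] {a θ : ι → ℝ} (ha0 : ∀ i, 0 ≤ a i)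
    (ha1 : ∀ i, a i ≤ 1) (hθ0 : ∀ i, 0 ≤ θ i) (hθ : ∑ i, θ i = 1) :
    ∏ i, a i ≤ ∑ i, θ i * (a i ^ 2) ^ (1 / (2 * θ i)) := by
  refine le_trans (Finset.prod_le_prod (fun i _ => ha0 i) fun i _ => ?_)
    (Real.geom_mean_le_arith_mean_weighted Finset.univ θ
      (fun i => (a i ^ 2) ^ (1 / (2 * θ i))) (fun i _ => hθ0 i) hθ
      fun i _ => Real.rpow_nonneg (sq_nonneg _) _)
  rcases (hθ0 i).eq_or_lt with h | h
  · rw [← h, Real.rpow_zero]; exact ha1 i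
  · rw [← Real.rpow_mul (sq_nonneg _), ← Real.rpow_natCast, ← Real.rpow_mul (ha0 i)]
    have : ((2 : ℕ) : ℝ) * (1 / (2 * θ i) * θ i) = 1 := by push_cast; field_simp
    rw [this, Real.rpow_one]

/-- The main bound when no summand dominates. -/
theorem maxProb_sum_le_inv_sqrt {ι : Type*} [Fintype ι] {X : ι → Ω → ℤ}
    (hX : ∀ i, Measurable (X i)) (h : iIndepFun X P) {D : ℝ} (hD : D = ∑ i, deltaInfty P (X i))
    (hD0 : 0 < D) (hsmall : ∀ i, deltaInfty P (X i) ≤ D / 22) :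
    maxProb P (fun ω => ∑ i, X i ω) ≤ (√(1 + D / 22))⁻¹ := by
  set θ : ι → ℝ := fun i => deltaInfty P (X i) / D with hθdef
  have hθ0 : ∀ i, 0 ≤ θ i := fun i => div_nonneg (deltaInfty_nonneg _) hD0.le
  have hθ : ∑ i, θ i = 1 := by rw [hθdef, ← Finset.sum_div, ← hD, div_self hD0.ne']
  set m : ι → ℕ → ℝ := fun i p => maxProb P (X i) + P.real {ω | (p : ℤ) ≤ 2 * |X i ω|} with hm
  have hmlim : ∀ i, Filter.Tendsto (m i) Filter.atTop (nhds (maxProb P (X i))) := fun i => by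
    simpa using (tendsto_tailProb (P := P) (hX i)).const_add (maxProb P (X i))
  set u : ℕ → ℝ := fun p => ∑ i, θ i *
    (1 / p + (√(1 + 1 / (2 * θ i) * (m i p ^ (-2 : ℤ) - 1) / 11))⁻¹) with hu
  have hulim : Filter.Tendsto u Filter.atTop (nhds (√(1 + D / 22))⁻¹) := by
    have h1 : ∑ i, θ i * (0 + (√(1 + D / 22))⁻¹) = (√(1 + D / 22))⁻¹ := by
      rw [← Finset.sum_mul, hθ, zero_add, one_mul]
    rw [← h1]
    refine tendsto_finsetSum _ fun i _ => ?_
    rcases (hθ0 i).eq_or_lt with h0 | h0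
    · simp [← h0]
    refine Filter.Tendsto.const_mul _ (tendsto_one_div_atTop_nhds_zero_nat.add ?_)
    -- The weights were chosen so that this value does not depend on i.
    have h2 : 1 + D / 22 = 1 + 1 / (2 * θ i) * (maxProb P (X i) ^ (-2 : ℤ) - 1) / 11 := by
      have h3 : maxProb P (X i) ^ (-2 : ℤ) - 1 = θ i * D := by
        simp only [hθdef]; rw [div_mul_cancel₀ _ hD0.ne']; rfl
      rw [h3]; field_simp; ring
    rw [h2]
    refine Filter.Tendsto.inv₀ (Filter.Tendsto.sqrt ?_) ?_
    · exact ((((hmlim i).zpow₀ (-2) (Or.inl (maxProb_pos _).ne')).sub_const 1).const_mul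
        _).div_const 11 |>.const_add 1
    · rw [← h2]; positivity
  refine ciSup_le fun k => ge_of_tendsto_of_frequently hulim ?_
  -- Positive weight excludes an almost surely constant X_i, so the moment bound applies once the
  -- tail is small.
  have hev : ∀ᶠ p in Filter.atTop, ∀ i, 0 < θ i → m i p < 1 := by
    rw [Filter.eventually_all]
    intro i
    by_cases h0 : 0 < θ i
    · have : maxProb P (X i) < 1 := by
        by_contra hc
        simp only [hθdef, deltaInfty_eq_zero_of_not_lt hc, zero_div, lt_irrefl] at h0
      filter_upwards [(hmlim i).eventually_lt_const this] with p hp _ using hp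
    · exact Filter.Eventually.of_forall fun p hc => absurd hc h0
  have hpr : ∃ᶠ p : ℕ in Filter.atTop, p.Prime := by
    rw [Filter.frequently_atTop]
    exact fun N => (Nat.exists_infinite_primes N).imp fun p hp => ⟨hp.1, hp.2⟩
  refine (hpr.and_eventually hev).mono fun p ⟨hp, hpm⟩ => ?_
  have : NeZero p := ⟨hp.ne_zero⟩
  have hp0 : (0 : ℝ) < p := by exact_mod_cast hp.pos
  refine (prob_sum_le hX h p k).trans ?_
  rw [div_le_iff₀ hp0]
  calc ∑ j : ZMod p, ∏ i, ‖∫ ω, (ZMod.stdAddChar (j * (X i ω : ZMod p)) : ℂ) ∂P‖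
      ≤ ∑ j : ZMod p, ∑ i, θ i *
        (‖∫ ω, (ZMod.stdAddChar (j * (X i ω : ZMod p)) : ℂ) ∂P‖ ^ 2) ^ (1 / (2 * θ i)) :=
        Finset.sum_le_sum fun j _ => prod_le_sum_mul_rpow (fun _ => norm_nonneg _)
          (fun i => norm_integral_stdAddChar_le_one (X i) j) hθ0 hθ
    _ = ∑ i, θ i * ∑ j : ZMod p,
        (‖∫ ω, (ZMod.stdAddChar (j * (X i ω : ZMod p)) : ℂ) ∂P‖ ^ 2) ^ (1 / (2 * θ i)) := by
        rw [Finset.sum_comm]; simp only [Finset.mul_sum]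
    _ ≤ ∑ i, θ i * (1 + p * (√(1 + 1 / (2 * θ i) * (m i p ^ (-2 : ℤ) - 1) / 11))⁻¹) := by
        refine Finset.sum_le_sum fun i _ => ?_
        rcases (hθ0 i).eq_or_lt with h0 | h0
        · rw [← h0, zero_mul, zero_mul]
        refine mul_le_mul_of_nonneg_left
          (sum_norm_integral_rpow_le hp (hX i) ?_ (hpm i h0)) (hθ0 i)
        rw [le_div_iff₀ (by positivity)]
        -- This is exactly q = 1/(2θ_i) ≥ 11, the point where the absence of a dominant summand is
        -- used.
        have : θ i ≤ 1 / 22 := by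
          simp only [hθdef]
          rw [div_le_iff₀ hD0]
          linarith [hsmall i]
        linarith
    _ = u p * p := by
        simp only [hu]
        rw [Finset.sum_mul]
        refine Finset.sum_congr rfl fun i _ => ?_
        field_simp

end Probability

theorem mainTheorem5 {Ω : Type*} [MeasurableSpace Ω] (P : Measure Ω) [IsProbabilityMeasure P]
    (n : ℕ) (X : Fin n → Ω → ℤ) (hX : ∀ i, Measurable (X i)) (hindep : iIndepFun X P) :
    (1 / 22 : ℝ) * ∑ i, deltaInfty P (X i) ≤ deltaInfty P (fun ω => ∑ i, X i ω) := by
  set D := ∑ i, deltaInfty P (X i) with hD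
  have hDn : 0 ≤ D := Finset.sum_nonneg fun i _ => deltaInfty_nonneg _
  by_cases hbig : ∃ i, D / 22 < deltaInfty P (X i)
  · obtain ⟨i, hi⟩ := hbig
    have := deltaInfty_anti (maxProb_sum_le hX hindep i)
    linarith
  push Not at hbig
  -- D = 0 is treated apart because the weights divide by D.
  rcases hDn.eq_or_lt with h0 | h0
  · rw [← h0, mul_zero]
    exact deltaInfty_nonneg _
  · have := le_deltaInfty_of_maxProb_le (by positivity)
      (maxProb_sum_le_inv_sqrt hX hindep hD h0 hbig)
    linarith
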